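/- Let $P$ be a finite set of points in the Euclidean plane, let $G=(P,E)$ be the complete graph on $P$ in which every edge $ij$ is drawn as the closed straight segment between $i$ and $j$, and for $S\subseteq P$ let $\delta(S)=\{ij\in E : i\in S,\ j\notin S\}$. Let $\mathcal L$ be any non-empty family of lines in the plane (for example all lines, or all axis-parallel lines). A *fractional perfect matching of minimum stabbing number* of $P$ (with respect to $\mathcal L$) is a vector $x\in\mathbb R^E$ which, together with some $k\in\mathbb R$, is an optimal solution of the linear program $$\min k\quad\text{s.t.}\quad \sum_{e\in\delta(\{i\})}x_e=1\ (i\in P),\quad \sum_{e\in\delta(S)}x_e\ge 1\ (\emptyset\ne S\subsetneq P,\ |S|\text{ odd}),\quad \sum_{e:\,e\cap\ell\neq\emptyset}x_e\le k\ (\ell\in\mathcal L),\quad x\ge 0.$$ A *fractional spanning tree of minimum stabbing number* of $P$ (with respect to $\mathcal L$) is a vector $x\in\mathbb R^E$ which, together with some $k\in\mathbb R$, is an optimal solution of the linear program $$\min k\quad\text{s.t.}\quad \sum_{e\in E}x_e=|P|-1,\quad \sum_{e\in\delta(S)}x_e\ge 1\ (\emptyset\ne S\subsetneq P),\quad \sum_{e:\,e\cap\ell\neq\emptyset}x_e\le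 k\ (\ell\in\mathcal L),\quad x\ge 0.$$ **Theorem.** (a) If $P$ is non-empty and $|P|$ is even, then there is a fractional perfect matching $x$ of $P$ of minimum stabbing number with an edge $e\in E$ of weight $x_e\ge 1/5$. (b) If $|P|\ge 2$, then there is a fractional spanning tree $x$ of $P$ of minimum stabbing number with an edge $e\in E$ of weight $x_e>1/3$. -/

import Mathlib

namespace StabbingLP

/-- The Euclidean plane. -/
abbrev Plane : Type := EuclideanSpace ℝ (Fin 2)

/-- A straight line in the plane: an affine subspace of dimension one. -/
def IsLine (l : AffineSubspace ℝ Plane) : Prop :=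
  Module.finrank ℝ l.direction = 1

/-- The edges of the complete graph whose vertex set is the finite point set `P`. -/
abbrev Edge (P : Finset Plane) : Type := (⊤ : SimpleGraph P).edgeSet

/-- The closed straight-line segment that embeds an edge. -/
def edgeSegment {P : Finset Plane} (e : Edge P) : Set Plane :=
  Sym2.lift ⟨fun i j : P => segment ℝ (i : Plane) (j : Plane),
    fun i j => segment_symm ℝ (i : Plane) (j : Plane)⟩ e.1

/-- The cut `δ(S)`: the edges with one endpoint in `S` and the other one outside `S`. -/
def cut {P : Finset Plane} (S : Finset P) : Set (Edge P) :=
  {e | ∃ i ∈ S, ∃ j ∉ S, e.1 = s(i, j)}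

/-- The edges whose segment is intersected by the line `l`. -/
def stabbed {P : Finset Plane} (l : AffineSubspace ℝ Plane) : Set (Edge P) :=
  {e | (edgeSegment e ∩ (l : Set Plane)).Nonempty}

open Classical in
/-- The total weight `∑_{e ∈ F} x_e` of a set of edges `F`. -/
noncomputable def weight {P : Finset Plane} (x : Edge P → ℝ) (F : Set (Edge P)) : ℝ :=
  ∑ e : Edge P with e ∈ F, x e

/-- `(x, k)` is a feasible solution of the linear programming relaxation of the
minimum stabbing number perfect matching problem on `P`, with stabbing lines `L`. -/
structure MatchingFeasible (P : Finset Plane) (L : Set (AffineSubspace ℝ Plane))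
    (x : Edge P → ℝ) (k : ℝ) : Prop where
  degree : ∀ i : P, weight x (cut {i}) = 1
  blossom : ∀ S : Finset P, S.Nonempty → S ≠ Finset.univ → Odd S.card → 1 ≤ weight x (cut S)
  stabbing : ∀ l ∈ L, weight x (stabbed l) ≤ k
  nonneg : ∀ e, 0 ≤ x e

/-- `(x, k)` is a feasible solution of the linear programming relaxation of the
minimum stabbing number spanning tree problem on `P`, with stabbing lines `L`. -/
structure TreeFeasible (P : Finset Plane) (L : Set (AffineSubspace ℝ Plane))
    (x : Edge P → ℝ) (k : ℝ) : Prop where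
  total : weight x Set.univ = (P.card : ℝ) - 1
  connected : ∀ S : Finset P, S.Nonempty → S ≠ Finset.univ → 1 ≤ weight x (cut S)
  stabbing : ∀ l ∈ L, weight x (stabbed l) ≤ k
  nonneg : ∀ e, 0 ≤ x e

/-- `x` is a fractional perfect matching of minimum stabbing number: together with some
value `k` it is a feasible solution that minimizes the objective `k`. -/
def IsOptimalMatching (P : Finset Plane) (L : Set (AffineSubspace ℝ Plane))
    (x : Edge P → ℝ) : Prop :=
  ∃ k : ℝ, MatchingFeasible P L x k ∧
    ∀ (x' : Edge P → ℝ) (k' : ℝ), MatchingFeasible P L x' k' → k ≤ k'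

/-- `x` is a fractional spanning tree of minimum stabbing number: together with some
value `k` it is a feasible solution that minimizes the objective `k`. -/
def IsOptimalTree (P : Finset Plane) (L : Set (AffineSubspace ℝ Plane))
    (x : Edge P → ℝ) : Prop :=
  ∃ k : ℝ, TreeFeasible P L x k ∧
    ∀ (x' : Edge P → ℝ) (k' : ℝ), TreeFeasible P L x' k' → k ≤ k'

end StabbingLP

/-! Among the optimal solutions take one of least total edge length, with lengths measured after a
tiny move of the points into general position. Its support is then drawn without crossings. Suppose
that support edges ij and kl cross. Moving a little weight from them to ik and jl, or to il and jk,
strictly shortens the solution (`dist_exchange`). It increases the load of no line (`stab_exchange`,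
applied to the original points, since the perturbation creates no new intersections), and it keeps
the equations. So the first move fails only through a tight cut S separating i, k from j, l, and the
second only through a tight T separating i, l from j, k. Two such sets cross, and uncrossing them
yields total cut weight above 2 (`two_lt_weight_add_weight`), a contradiction.

A plane straight-line graph on n ≥ 2 points has at most 3n - 5 edges
(`PlaneDrawing.card_add_five_le`), and averaging over the support finishes. Matching weights all
below 1/5 would force support degrees of at least 6, so 6n ≤ 2(3n - 5). Tree weights all at most 1/3
would give n - 1 ≤ (3n - 5)/3.

The edge bound comes from charging rather than from Euler's formula. An edge that is topmost at its
left endpoint is charged to that endpoint. Any other edge f is charged to the first vertex met in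
the wedge between f and the next edge above it. -/

namespace StabbingLP

/-! ### Plane drawings and the edge bound -/

/-- The slope of a straight edge. -/
noncomputable def slope {ι : Type*} (x y : ι → ℝ) (e : ι × ι) : ℝ :=
  (y e.2 - y e.1) / (x e.2 - x e.1)

/-- The ordinate at the abscissa `t` of the line through an edge. -/
noncomputable def height {ι : Type*} (x y : ι → ℝ) (e : ι × ι) (t : ℝ) : ℝ :=
  y e.1 + slope x y e * (t - x e.1)

/-- A straight-line drawing without crossings: the vertices have distinct abscissae, no vertex lies
inside an edge, edges point to the right, and distinct edges have no common interior point. -/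
structure PlaneDrawing {ι : Type*} (x y : ι → ℝ) (E : Finset (ι × ι)) : Prop where
  inj : Function.Injective x
  lt : ∀ e ∈ E, x e.1 < x e.2
  disjoint : ∀ e ∈ E, ∀ f ∈ E, e ≠ f → ∀ t, x e.1 < t → t < x e.2 → x f.1 < t → t < x f.2 →
    height x y e t ≠ height x y f t
  vertex : ∀ e ∈ E, ∀ w, x e.1 < x w → x w < x e.2 → height x y e (x w) ≠ y w

namespace PlaneDrawing

variable {ι : Type*} {x y : ι → ℝ} {E : Finset (ι × ι)}

theorem height_left (x y : ι → ℝ) (e : ι × ι) : height x y e (x e.1) = y e.1 := by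
  simp [height]

theorem height_right (D : PlaneDrawing x y E) {e : ι × ι} (he : e ∈ E) :
    height x y e (x e.2) = y e.2 := by
  have h := sub_pos.2 (D.lt e he)
  rw [height, slope]; field_simp; ring

/-- Two edges do not change their vertical order. -/
theorem not_lt_of_lt (D : PlaneDrawing x y E) {e f : ι × ι} (he : e ∈ E) (hf : f ∈ E)
    {s t : ℝ} (hst : s < t) (hes : x e.1 ≤ s) (hfs : x f.1 ≤ s) (het : t ≤ x e.2) (hft : t ≤ x f.2)
    (h : height x y e s < height x y f s) : ¬ height x y f t < height x y e t := by
  intro h'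
  have hne : e ≠ f := by rintro rfl; exact lt_irrefl _ h
  have ha : 0 < height x y f s - height x y e s := sub_pos.2 h
  have hb : 0 < height x y e t - height x y f t := sub_pos.2 h'
  set a := height x y f s - height x y e s with hadef
  set b := height x y e t - height x y f t with hbdef
  have hab : 0 < a + b := by positivity
  have hts : 0 < t - s := sub_pos.2 hst
  have h1 : s < s + a / (a + b) * (t - s) := by
    have : 0 < a / (a + b) * (t - s) := by positivity
    linarith
  have h2 : s + a / (a + b) * (t - s) < t := by
    have : a / (a + b) < 1 := by rw [div_lt_one hab]; linarith
    nlinarith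
  -- The abscissa at which the affine height difference, `a` at `s` and `-b` at `t`, vanishes.
  refine D.disjoint e he f hf hne (s + a / (a + b) * (t - s)) (by linarith) (by linarith)
    (by linarith) (by linarith) ?_
  have key : ∀ g r, height x y g (s + r * (t - s)) = (1 - r) * height x y g s + r * height x y g t := by
    intro g r; simp only [height]; ring
  rw [key, key]
  have h3 : a / (a + b) * (a + b) = a := div_mul_cancel₀ _ hab.ne'
  have h4 : a / (a + b) * b = (1 - a / (a + b)) * a := by linarith
  generalize a / (a + b) = r at h4
  have : r * (height x y e t - height x y f t) = (1 - r) * (height x y f s - height x y e s) := h4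
  linarith

theorem eq_of_slope_eq (D : PlaneDrawing x y E) {e f : ι × ι} (he : e ∈ E) (hf : f ∈ E)
    (h : e.1 = f.1) (hs : slope x y e = slope x y f) : e = f := by
  by_contra hne
  have h1 := D.lt e he
  have h2 := D.lt f hf
  obtain ⟨t, ht1, ht2⟩ := exists_between (lt_min h1 (h ▸ h2))
  rw [lt_min_iff] at ht2
  refine D.disjoint e he f hf hne t ht1 ht2.1 (h ▸ ht1) ht2.2 ?_
  rw [height, height, hs, h]

/-- `e` is the next edge above `f` among those with the same left endpoint, and `w` is the first
vertex in the region between `f` and `e`. -/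
structure Wedge (x y : ι → ℝ) (E : Finset (ι × ι)) (f e : ι × ι) (w : ι) :
    Prop where
  memf : f ∈ E
  meme : e ∈ E
  left : e.1 = f.1
  slope_lt : slope x y f < slope x y e
  next : ∀ g ∈ E, g.1 = f.1 → slope x y f < slope x y g → slope x y e ≤ slope x y g
  lt : x f.1 < x w
  lef : x w ≤ x f.2
  lee : x w ≤ x e.2
  above : height x y f (x w) ≤ y w
  below : y w ≤ height x y e (x w)
  first : ∀ u, x f.1 < x u → x u < x w → height x y f (x u) ≤ y u → height x y e (x u) < y u

/-- The right end of whichever edge stops first lies in the closed region between `f` and the next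
edge, so the region contains a vertex, and a leftmost one can be chosen. -/
theorem exists_wedge [Finite ι] (D : PlaneDrawing x y E) {f : ι × ι} (hf : f ∈ E)
    (hn : ¬ ∀ g ∈ E, g.1 = f.1 → slope x y g ≤ slope x y f) :
    ∃ e w, Wedge x y E f e w := by
  classical
  push Not at hn
  obtain ⟨g, hg, hgf, hgs⟩ := hn
  obtain ⟨e, he, hemin⟩ := (E.filter fun g => g.1 = f.1 ∧ slope x y f < slope x y g).exists_min_image
    (slope x y) ⟨g, by simp [hg, hgf, hgs]⟩
  simp only [Finset.mem_filter] at he hemin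
  obtain ⟨heE, hel, hes⟩ := he
  have hle : ∀ t, x f.1 ≤ t → height x y f t ≤ height x y e t := by
    intro t ht
    rw [height, height, hel]
    have := mul_le_mul_of_nonneg_right hes.le (sub_nonneg.2 ht)
    linarith
  have h1 := D.lt f hf
  have h2 := D.lt e heE
  let R : Set ι := {w | x f.1 < x w ∧ x w ≤ x f.2 ∧ x w ≤ x e.2 ∧ height x y f (x w) ≤ y w ∧
    y w ≤ height x y e (x w)}
  have hR : R.Nonempty := by
    rcases le_total (x f.2) (x e.2) with h | h
    · refine ⟨f.2, h1, le_rfl, h, (D.height_right hf).le, ?_⟩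
      rw [← D.height_right hf]; exact hle _ h1.le
    · refine ⟨e.2, hel ▸ h2, h, le_rfl, ?_, (D.height_right heE).ge⟩
      rw [← D.height_right heE]; exact hle _ (hel ▸ h2.le)
  obtain ⟨w, hw, hwmin⟩ := R.toFinite.exists_minimalFor x R hR
  obtain ⟨w1, w2, w3, w4, w5⟩ := hw
  refine ⟨e, w, hf, heE, hel, hes, fun g hg hgf hgs => hemin g ⟨hg, hgf, hgs⟩, w1, w2, w3, w4, w5, ?_⟩
  intro u hu huw hfu
  by_contra hue
  exact absurd (hwmin ⟨hu, by linarith, by linarith, hfu, not_lt.1 hue⟩ huw.le) (not_le.2 huw)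

/-- No edge passes strictly inside a wedge at its first vertex. -/
theorem Wedge.not_between (D : PlaneDrawing x y E) {f e : ι × ι} {w : ι}
    (W : Wedge x y E f e w) {g : ι × ι} (hg : g ∈ E) (hg1 : x g.1 < x w) (hg2 : x w < x g.2)
    (h1 : height x y f (x w) < height x y g (x w)) : ¬ height x y g (x w) < height x y e (x w) := by
  intro h2
  have wl := W.lt
  have l1 := W.lef
  have l2 := W.lee
  have hel : x e.1 = x f.1 := by rw [W.left]
  -- If `g` starts left of the apex, it misses the apex and must change sides with `f` or `e`. If it
  -- starts at the apex, its slope contradicts `next`. If it starts later, `first` puts its left end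
  -- below `f` or above `e`, and it changes sides again.
  rcases lt_trichotomy (x g.1) (x f.1) with h | h | h
  · have hv := D.vertex g hg f.1 h (wl.trans hg2)
    rcases lt_or_gt_of_ne hv with h' | h'
    · rw [← height_left x y f] at h'
      exact D.not_lt_of_lt hg W.memf wl h.le le_rfl hg2.le l1 h' h1
    · rw [← W.left, ← height_left x y e, W.left] at h'
      exact D.not_lt_of_lt W.meme hg wl hel.le h.le l2 hg2.le h' h2
  · have h := D.inj h
    simp only [height, h] at h1
    simp only [height, h, W.left] at h2
    have p := sub_pos.2 wl
    have h1 : slope x y f < slope x y g := lt_of_mul_lt_mul_right (by linarith) p.le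
    have h2 : slope x y g < slope x y e := lt_of_mul_lt_mul_right (by linarith) p.le
    exact absurd (W.next g hg h h1) (not_le.2 h2)
  · rcases lt_or_ge (y g.1) (height x y f (x g.1)) with h' | h'
    · rw [← height_left x y g] at h'
      exact D.not_lt_of_lt hg W.memf hg1 le_rfl h.le hg2.le l1 h' h1
    · have h'' := W.first g.1 h hg1 h'
      rw [← height_left x y g] at h''
      exact D.not_lt_of_lt W.meme hg hg1 (hel ▸ h.le) le_rfl l2 hg2.le h'' h2

theorem Wedge.lt_right_left (D : PlaneDrawing x y E) {f e : ι × ι} {w : ι}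
    (W : Wedge x y E f e w) (hw : w = e.2) :
    x w < x f.2 ∧ height x y f (x w) < height x y e (x w) := by
  have hs : height x y f (x w) < height x y e (x w) := by
    rw [height, height, W.left]
    have := mul_lt_mul_of_pos_right W.slope_lt (sub_pos.2 W.lt)
    linarith
  refine ⟨lt_of_le_of_ne W.lef fun h => ?_, hs⟩
  have h := D.inj h
  have := W.slope_lt
  rw [Prod.ext W.left (hw.symm.trans h)] at this
  exact lt_irrefl _ this

theorem Wedge.lt_right_right (D : PlaneDrawing x y E) {f e : ι × ι} {w : ι}
    (W : Wedge x y E f e w) (hw : w ≠ e.2) :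
    x w < x e.2 ∧ y w < height x y e (x w) := by
  have h : x w < x e.2 := lt_of_le_of_ne W.lee fun h => hw (D.inj h)
  exact ⟨h, lt_of_le_of_ne W.below
    (D.vertex e W.meme w (by rw [W.left]; exact W.lt) h).symm⟩

/-- Both lower edges pass strictly below `w`, where both upper edges end. If they differed, the
higher one would run inside the wedge of the other. -/
theorem Wedge.eq_of_left (D : PlaneDrawing x y E) {f e f' e' : ι × ι} {w : ι}
    (W : Wedge x y E f e w) (W' : Wedge x y E f' e' w) (hw : w = e.2)
    (hw' : w = e'.2) : f = f' := by
  by_contra hne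
  obtain ⟨h1, h2⟩ := W.lt_right_left D hw
  obtain ⟨h1', h2'⟩ := W'.lt_right_left D hw'
  have e1 : height x y e (x w) = y w := by rw [hw, D.height_right W.meme]
  have e2 : height x y e' (x w) = y w := by rw [hw', D.height_right W'.meme]
  rcases lt_or_gt_of_ne (D.disjoint f W.memf f' W'.memf hne (x w) W.lt h1 W'.lt h1') with h | h
  · exact W.not_between D W'.memf W'.lt h1' h (by linarith)
  · exact W'.not_between D W.memf W.lt h1 h (by linarith)

/-- Both upper edges pass strictly above `w`. If they differ, the lower one runs inside the wedge of
the other. If they agree, `f` and `f'` are both the edge just below the common upper edge at the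
same apex. -/
theorem Wedge.eq_of_right (D : PlaneDrawing x y E) {f e f' e' : ι × ι} {w : ι}
    (W : Wedge x y E f e w) (W' : Wedge x y E f' e' w) (hw : w ≠ e.2)
    (hw' : w ≠ e'.2) : f = f' := by
  obtain ⟨h1, h2⟩ := W.lt_right_right D hw
  obtain ⟨h1', h2'⟩ := W'.lt_right_right D hw'
  have l : x e.1 < x w := by rw [W.left]; exact W.lt
  have l' : x e'.1 < x w := by rw [W'.left]; exact W'.lt
  have a := W.above
  have a' := W'.above
  by_cases hee : e = e'
  · subst hee
    have hl : f.1 = f'.1 := W.left.symm.trans W'.left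
    rcases lt_trichotomy (slope x y f) (slope x y f') with h | h | h
    · exact absurd (W.next f' W'.memf hl.symm h) (not_le.2 W'.slope_lt)
    · exact D.eq_of_slope_eq W.memf W'.memf hl h
    · exact absurd (W'.next f W.memf hl h) (not_le.2 W.slope_lt)
  · exfalso
    rcases lt_or_gt_of_ne (D.disjoint e W.meme e' W'.meme hee (x w) l h1 l' h1') with h | h
    · exact W'.not_between D W.meme l h1 (by linarith) h
    · exact W.not_between D W'.meme l' h1' (by linarith) h

/-- A crossing-free straight-line graph on `n ≥ 2` vertices has at most `3n - 5` edges. -/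
theorem card_add_five_le [Fintype ι] (D : PlaneDrawing x y E) (hn : 2 ≤ Fintype.card ι) :
    E.card + 5 ≤ 3 * Fintype.card ι := by
  classical
  have : Nonempty ι := Fintype.card_pos_iff.1 (by omega)
  obtain ⟨a, ha⟩ := Finite.exists_min x
  obtain ⟨b, hb⟩ := Finite.exists_max x
  have hab : a ≠ b := by
    rintro rfl
    have : Subsingleton ι := ⟨fun u v => D.inj (le_antisymm ((hb u).trans (ha v))
      ((hb v).trans (ha u)))⟩
    have := Fintype.card_le_one_iff_subsingleton.2 this
    omega
  let p : ι × ι → Prop := fun f => ∀ g ∈ E, g.1 = f.1 → slope x y g ≤ slope x y f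
  -- A topmost edge is determined by its left endpoint, which is never the rightmost vertex `b`.
  have htop : (E.filter p).card ≤ Fintype.card ι - 1 := by
    rw [← Finset.card_univ, ← Finset.card_erase_of_mem (Finset.mem_univ b)]
    refine Finset.card_le_card_of_injOn Prod.fst ?_ ?_
    · intro e he
      have he := (Finset.mem_filter.1 he).1
      simp only [Finset.coe_erase, Finset.coe_univ, Set.mem_sdiff, Set.mem_univ, true_and,
        Set.mem_singleton_iff]
      intro h
      exact absurd (D.lt e he) (not_lt.2 (h ▸ hb _))
    · intro e he f hf h
      obtain ⟨he, hep⟩ := Finset.mem_filter.1 he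
      obtain ⟨hf, hfp⟩ := Finset.mem_filter.1 hf
      exact D.eq_of_slope_eq he hf h (le_antisymm (hfp e he h) (hep f hf h.symm))
  have hW : ∀ f : ι × ι, ∃ ew : (ι × ι) × ι, f ∈ E → ¬ p f →
      Wedge x y E f ew.1 ew.2 := by
    intro f
    by_cases h : f ∈ E ∧ ¬ p f
    · obtain ⟨e, w, W⟩ := D.exists_wedge h.1 h.2
      exact ⟨(e, w), fun _ _ => W⟩
    -- An arbitrary value: only edges of `E` that are not topmost are charged to wedges.
    · exact ⟨(f, f.1), fun h1 h2 => absurd ⟨h1, h2⟩ h⟩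
  choose ew hew using hW
  -- Each vertex other than `a` and `b` is charged at most twice: once as the right end of the
  -- wedge's upper edge and once otherwise. The Boolean records which.
  have hnon : (E.filter fun f => ¬ p f).card ≤ (Fintype.card ι - 2) * 2 := by
    have hc : (((Finset.univ.erase b).erase a) ×ˢ (Finset.univ : Finset Bool)).card =
        (Fintype.card ι - 2) * 2 := by
      rw [Finset.card_product, Finset.card_erase_of_mem (by simp [hab]),
        Finset.card_erase_of_mem (Finset.mem_univ b), Finset.card_univ]
      simp [Nat.sub_sub]
    rw [← hc]
    refine Finset.card_le_card_of_injOn (fun f => ((ew f).2, decide ((ew f).2 = (ew f).1.2))) ?_ ?_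
    · intro f hf
      obtain ⟨hf, hfp⟩ := Finset.mem_filter.1 hf
      have W := hew f hf hfp
      have h1 : (ew f).2 ≠ a := fun h => absurd W.lt (not_lt.2 (h ▸ ha _))
      have h2 : (ew f).2 ≠ b := by
        intro h
        by_cases hw : (ew f).2 = (ew f).1.2
        · exact absurd (W.lt_right_left D hw).1 (not_lt.2 (h ▸ hb _))
        · exact absurd (W.lt_right_right D hw).1 (not_lt.2 (h ▸ hb _))
      simp [h1, h2, em]
    · intro f hf g hg h
      obtain ⟨hf, hfp⟩ := Finset.mem_filter.1 hf
      obtain ⟨hg, hgp⟩ := Finset.mem_filter.1 hg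
      have W := hew f hf hfp
      have W' := hew g hg hgp
      simp only [Prod.mk.injEq, decide_eq_decide] at h
      rw [← h.1] at W'
      by_cases hw : (ew f).2 = (ew f).1.2
      · exact W.eq_of_left D W' hw (h.1.trans (h.2.1 hw))
      · exact W.eq_of_right D W' hw (fun h' => hw (h.2.2 (h.1.symm.trans h')))
  have := Finset.card_filter_add_card_filter_not (s := E) p
  omega

end PlaneDrawing

/-! ### Lines and the exchange of crossing segments -/

/-- The quotient of the plane by the direction of the line is one-dimensional, so a coordinate on
it, based at a point of the line, is a defining function. -/
theorem exists_affine_of_isLine {l : AffineSubspace ℝ Plane} (hl : IsLine l) :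
    ∃ f : Plane → ℝ, (∀ p, p ∈ l ↔ f p = 0) ∧
      ∀ (a b : ℝ) (p q : Plane), a + b = 1 → f (a • p + b • q) = a * f p + b * f q := by
  have hne : (l : Set Plane).Nonempty := by
    rw [Set.nonempty_iff_ne_empty]
    intro h
    have h : l = ⊥ := by rwa [AffineSubspace.coe_eq_bot_iff] at h
    subst h
    rw [IsLine, AffineSubspace.direction_bot, finrank_bot] at hl
    exact zero_ne_one hl
  obtain ⟨p₀, hp₀⟩ := hne
  have hq : Module.finrank ℝ (Plane ⧸ l.direction) = Module.finrank ℝ ℝ := by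
    have h := Submodule.finrank_quotient_add_finrank l.direction
    have h2 : Module.finrank ℝ Plane = 2 := by simp [Plane]
    rw [h2, show Module.finrank ℝ l.direction = 1 from hl] at h
    rw [Module.finrank_self]; omega
  let φ := LinearEquiv.ofFinrankEq (Plane ⧸ l.direction) ℝ hq
  refine ⟨fun p => φ (l.direction.mkQ (p - p₀)), fun p => ?_, fun a b p q hab => ?_⟩
  · rw [LinearEquiv.map_eq_zero_iff, Submodule.mkQ_apply, Submodule.Quotient.mk_eq_zero,
      ← vsub_eq_sub, AffineSubspace.vsub_right_mem_direction_iff_mem hp₀]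
  · have : a • p + b • q - p₀ = a • (p - p₀) + b • (q - p₀) := by
      have h : p₀ = (a + b) • p₀ := by rw [hab, one_smul]
      conv_lhs => rw [h]
      module
    simp only [this, map_add, map_smul, smul_eq_mul]

theorem segment_inter_nonempty_iff {l : Set Plane} {f : Plane → ℝ} (hf : ∀ p, p ∈ l ↔ f p = 0)
    (hf' : ∀ (a b : ℝ) (p q : Plane), a + b = 1 → f (a • p + b • q) = a * f p + b * f q)
    (p q : Plane) : (segment ℝ p q ∩ l).Nonempty ↔ f p * f q ≤ 0 := by
  constructor
  · rintro ⟨z, ⟨a, b, ha, hb, hab, rfl⟩, hz⟩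
    rw [hf, hf' _ _ _ _ hab] at hz
    by_contra! h
    have hp : f p ≠ 0 := left_ne_zero_of_mul h.ne'
    have h0 : a * (f p * f p) + b * (f p * f q) = 0 := by linear_combination f p * hz
    have h1 : 0 < f p * f p := mul_self_pos.2 hp
    rcases ha.eq_or_lt with rfl | ha
    · simp at hab; subst hab; linarith
    · have := mul_pos ha h1
      have := mul_nonneg hb h.le
      linarith
  · intro h
    by_cases h0 : f p = 0
    · exact ⟨p, left_mem_segment ℝ p q, (hf p).2 h0⟩
    · have hpq : f p - f q ≠ 0 := by
        intro h1
        have : f q = f p := by linarith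
        rw [this] at h
        exact absurd (mul_self_pos.2 h0) (not_lt.2 h)
      have hsq : 0 < (f p - f q) * (f p - f q) := mul_self_pos.2 hpq
      have hs : f p / (f p - f q) = f p * (f p - f q) / ((f p - f q) * (f p - f q)) := by field_simp
      have hs' : -f q / (f p - f q) = -f q * (f p - f q) / ((f p - f q) * (f p - f q)) := by
        field_simp
      have hsum : -f q / (f p - f q) + f p / (f p - f q) = 1 := by field_simp; ring
      refine ⟨(-f q / (f p - f q)) • p + (f p / (f p - f q)) • q, ⟨_, _, ?_, ?_, hsum, rfl⟩, ?_⟩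
      · rw [hs']; apply div_nonneg _ hsq.le; nlinarith [mul_self_nonneg (f q)]
      · rw [hs]; apply div_nonneg _ hsq.le; nlinarith [mul_self_nonneg (f p)]
      · rw [hf, hf' _ _ _ _ hsum]; field_simp; ring

open Classical in
/-- Replacing two intersecting segments by two segments that reconnect their endpoints does not
increase the number of intersections with a line. -/
theorem stab_exchange {l : AffineSubspace ℝ Plane} (hl : IsLine l) {p q r s : Plane}
    (h : (segment ℝ p q ∩ segment ℝ r s).Nonempty) :
    (if (segment ℝ p r ∩ (l : Set Plane)).Nonempty then (1 : ℝ) else 0) +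
      (if (segment ℝ q s ∩ (l : Set Plane)).Nonempty then 1 else 0) ≤
    (if (segment ℝ p q ∩ (l : Set Plane)).Nonempty then 1 else 0) +
      (if (segment ℝ r s ∩ (l : Set Plane)).Nonempty then 1 else 0) := by
  obtain ⟨f, hf, hf'⟩ := exists_affine_of_isLine hl
  obtain ⟨z, ⟨a, b, ha, hb, hab, hz⟩, ⟨c, d, hc, hd, hcd, hz'⟩⟩ := h
  have key : a * f p + b * f q = c * f r + d * f s := by
    rw [← hf' _ _ _ _ hab, ← hf' _ _ _ _ hcd, hz, hz']
  have hf : ∀ p, p ∈ (l : Set Plane) ↔ f p = 0 := hf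
  simp only [segment_inter_nonempty_iff hf hf']
  have comb : ∀ {a b u v : ℝ}, 0 ≤ a → 0 ≤ b → a + b = 1 → 0 < u → 0 < v → 0 < a * u + b * v := by
    intro a b u v ha hb hab hu hv
    rcases ha.eq_or_lt with rfl | ha
    · simp at hab; subst hab; linarith
    · have := mul_pos ha hu
      have := mul_nonneg hb hv.le
      linarith
  have comb' : ∀ {a b u v : ℝ}, 0 ≤ a → 0 ≤ b → u ≤ 0 → v ≤ 0 → a * u + b * v ≤ 0 := by
    intro a b u v ha hb hu hv
    have := mul_nonpos_of_nonneg_of_nonpos ha hu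
    have := mul_nonpos_of_nonneg_of_nonpos hb hv
    linarith
  generalize f p = p at *
  generalize f q = q at *
  generalize f r = r at *
  generalize f s = s at *
  -- If both new segments are stabbed, so is each old one: were `p`, `q` strictly on one side, `r`,
  -- `s` would be weakly on the other, and the common point could not exist.
  have side : ∀ {a b c d p q r s : ℝ}, 0 ≤ a → 0 ≤ b → a + b = 1 → 0 ≤ c → 0 ≤ d → c + d = 1 →
      a * p + b * q = c * r + d * s → p * r ≤ 0 → q * s ≤ 0 → p * q ≤ 0 := by
    intro a b c d p q r s ha hb hab hc hd hcd key h1 h2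
    by_contra! h
    rcases pos_and_pos_or_neg_and_neg_of_mul_pos h with ⟨hp, hq⟩ | ⟨hp, hq⟩
    · have hr : r ≤ 0 := nonpos_of_mul_nonpos_right h1 hp
      have hs : s ≤ 0 := nonpos_of_mul_nonpos_right h2 hq
      have := comb ha hb hab hp hq
      have := comb' hc hd hr hs
      linarith
    · have hr : 0 ≤ r := by by_contra! h'; exact absurd (mul_pos_of_neg_of_neg hp h') (not_lt.2 h1)
      have hs : 0 ≤ s := by by_contra! h'; exact absurd (mul_pos_of_neg_of_neg hq h') (not_lt.2 h2)
      have := comb ha hb hab (neg_pos.2 hp) (neg_pos.2 hq)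
      have := comb' hc hd (neg_nonpos.2 hr) (neg_nonpos.2 hs)
      linarith
  -- If one new segment is stabbed, so is at least one old one: otherwise the two old segments lie
  -- strictly on single sides, which agree because of the common point.
  have one : ∀ {a b c d p q r s : ℝ}, 0 ≤ a → 0 ≤ b → a + b = 1 → 0 ≤ c → 0 ≤ d → c + d = 1 →
      a * p + b * q = c * r + d * s → p * r ≤ 0 → 0 < p * q → r * s ≤ 0 := by
    intro a b c d p q r s ha hb hab hc hd hcd key h1 h2
    by_contra! h
    rcases pos_and_pos_or_neg_and_neg_of_mul_pos h2 with ⟨hp, hq⟩ | ⟨hp, hq⟩ <;>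
    rcases pos_and_pos_or_neg_and_neg_of_mul_pos h with ⟨hr, hs⟩ | ⟨hr, hs⟩
    · exact absurd (mul_pos hp hr) (not_lt.2 h1)
    · have := comb ha hb hab hp hq
      have := comb hc hd hcd (neg_pos.2 hr) (neg_pos.2 hs)
      linarith
    · have := comb hc hd hcd hr hs
      have := comb ha hb hab (neg_pos.2 hp) (neg_pos.2 hq)
      linarith
    · exact absurd (mul_pos_of_neg_of_neg hp hr) (not_lt.2 h1)
  by_cases h1 : p * r ≤ 0 <;> by_cases h2 : q * s ≤ 0
  · have h3 := side ha hb hab hc hd hcd key h1 h2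
    have h4 : r * s ≤ 0 := side hc hd hcd ha hb hab key.symm (by linarith) (by linarith)
    simp [h1, h2, h3, h4]
  · by_cases h3 : p * q ≤ 0
    · simp only [h1, h2, h3, if_true, if_false]; split_ifs <;> norm_num
    · have h4 := one ha hb hab hc hd hcd key h1 (not_le.1 h3)
      simp [h1, h2, h3, h4]
  · by_cases h3 : p * q ≤ 0
    · simp only [h1, h2, h3, if_true, if_false]; split_ifs <;> norm_num
    · have h4 := one hb ha (by linarith) hd hc (by linarith) (by linarith : b * q + a * p = d * s + c * r)
        h2 (by linarith [not_le.1 h3])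
      have h4 : r * s ≤ 0 := by linarith
      simp [h1, h2, h3, h4]
  · simp only [h1, h2, if_false]; split_ifs <;> norm_num

/-! ### Perturbation into general position -/

theorem eventually_quadratic_ne_zero {a b c : ℝ} (h : c ≠ 0 ∨ b ≠ 0) :
    ∀ᶠ t in nhdsWithin (0 : ℝ) {0}ᶜ, a + b * t + c * t ^ 2 ≠ 0 := by
  open Polynomial in
  let P : ℝ[X] := C a + C b * X + C c * X ^ 2
  have hP : P ≠ 0 := by
    intro h0
    have h1 := congrArg (fun Q => Q.coeff 1) h0
    have h2 := congrArg (fun Q => Q.coeff 2) h0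
    simp [P, Polynomial.coeff_C, Polynomial.coeff_X_pow] at h1 h2
    rcases h with h | h <;> contradiction
  have hfin : {t : ℝ | P.IsRoot t}.Finite := Polynomial.finite_setOfPred_isRoot hP
  have := nhdsNE_le_cofinite (0 : ℝ) hfin.compl_mem_cofinite
  filter_upwards [this] with t ht h0
  exact ht (by simpa [P, Polynomial.IsRoot] using h0)

/-- The difference of two points, one on each segment, is continuous in `t` and in parameters from
the compact unit square, so its nonvanishing at `t = 0` persists nearby. -/
theorem eventually_segment_disjoint {p q r s : ℝ → Plane} (hp : Continuous p) (hq : Continuous q)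
    (hr : Continuous r) (hs : Continuous s)
    (h : ¬ (segment ℝ (p 0) (q 0) ∩ segment ℝ (r 0) (s 0)).Nonempty) :
    ∀ᶠ t in nhds (0 : ℝ), ¬ (segment ℝ (p t) (q t) ∩ segment ℝ (r t) (s t)).Nonempty := by
  let K : Set (ℝ × ℝ) := Set.Icc 0 1 ×ˢ Set.Icc 0 1
  have hK : IsCompact K := isCompact_Icc.prod isCompact_Icc
  let F : ℝ × (ℝ × ℝ) → Plane := fun z => ((1 - z.2.1) • p z.1 + z.2.1 • q z.1) -
    ((1 - z.2.2) • r z.1 + z.2.2 • s z.1)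
  have hF : Continuous F := by fun_prop
  have hev : ∀ᶠ t in nhds (0 : ℝ), ∀ z ∈ K, F (t, z) ≠ 0 := by
    refine hK.eventually_forall_of_forall_eventually fun z hz => ?_
    refine hF.continuousAt.eventually_ne ?_
    intro h0
    refine h ⟨(1 - z.1) • p 0 + z.1 • q 0, ⟨_, _, sub_nonneg.2 hz.1.2, hz.1.1, by ring, rfl⟩, ?_⟩
    rw [sub_eq_zero.1 h0]
    exact ⟨_, _, sub_nonneg.2 hz.2.2, hz.2.1, by ring, rfl⟩
  filter_upwards [hev] with t ht
  rintro ⟨z, ⟨a, b, ha, hb, hab, hz⟩, ⟨c, d, hc, hd, hcd, hz'⟩⟩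
  refine ht (b, d) ⟨⟨hb, by linarith⟩, ⟨hd, by linarith⟩⟩ ?_
  simp only [F]
  rw [show 1 - b = a by linarith, show 1 - d = c by linarith, hz, hz', sub_self]

/-- Twice the signed area of the triangle `pqr`. -/
def det (p q r : Plane) : ℝ := (q 0 - p 0) * (r 1 - p 1) - (r 0 - p 0) * (q 1 - p 1)

/-- A finite family of points can be moved into general position without creating new
intersections of segments. -/
theorem exists_general_position {ι : Type*} [Finite ι] (p : ι → Plane) :
    ∃ q : ι → Plane, Function.Injective (fun i => q i 0) ∧
      (∀ i j k, i ≠ j → i ≠ k → j ≠ k → det (q i) (q j) (q k) ≠ 0) ∧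
      ∀ i j k l, (segment ℝ (q i) (q j) ∩ segment ℝ (q k) (q l)).Nonempty →
        (segment ℝ (p i) (p j) ∩ segment ℝ (p k) (p l)).Nonempty := by
  obtain ⟨n, ⟨φ⟩⟩ := Finite.exists_equiv_fin ι
  let s : ι → ℝ := fun i => ((φ i : ℕ) : ℝ)
  have hs : ∀ i j, i ≠ j → s i - s j ≠ 0 := by
    intro i j hij h
    exact hij (φ.injective (Fin.ext (Nat.cast_injective (sub_eq_zero.1 h))))
  -- The points move along distinct vectors of the parabola, so the `t ^ 2` coefficient of each
  -- determinant is a nonzero Vandermonde product, whatever the original points are.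
  let q : ℝ → ι → Plane := fun t i => p i + t • !₂[s i, s i ^ 2]
  have hq : ∀ i, Continuous fun t => q t i := by intro i; fun_prop
  have e1 : ∀ᶠ t in nhdsWithin (0 : ℝ) {0}ᶜ, ∀ i j, i ≠ j → q t i 0 - q t j 0 ≠ 0 := by
    simp only [Filter.eventually_all]
    intro i j hij
    filter_upwards [eventually_quadratic_ne_zero (a := p i 0 - p j 0) (b := s i - s j) (c := 0)
      (Or.inr (hs i j hij))] with t ht h
    apply ht
    simp [q] at h
    linear_combination h
  have e2 : ∀ᶠ t in nhdsWithin (0 : ℝ) {0}ᶜ, ∀ i j k, i ≠ j → i ≠ k → j ≠ k →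
      det (q t i) (q t j) (q t k) ≠ 0 := by
    simp only [Filter.eventually_all]
    intro i j k hij hik hjk
    filter_upwards [eventually_quadratic_ne_zero (a := det (p i) (p j) (p k))
      (b := (p j 0 - p i 0) * (s k ^ 2 - s i ^ 2) + (s j - s i) * (p k 1 - p i 1)
        - (p k 0 - p i 0) * (s j ^ 2 - s i ^ 2) - (s k - s i) * (p j 1 - p i 1))
      (c := (s j - s i) * (s k - s i) * (s k - s j))
      (Or.inl (mul_ne_zero (mul_ne_zero (hs _ _ hij.symm) (hs _ _ hik.symm)) (hs _ _ hjk.symm)))]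
      with t ht h
    apply ht
    simp [q, det] at h ⊢
    linear_combination h
  have e3 : ∀ᶠ t in nhdsWithin (0 : ℝ) {0}ᶜ, ∀ i j k l,
      (segment ℝ (q t i) (q t j) ∩ segment ℝ (q t k) (q t l)).Nonempty →
        (segment ℝ (p i) (p j) ∩ segment ℝ (p k) (p l)).Nonempty := by
    refine Filter.Eventually.filter_mono nhdsWithin_le_nhds ?_
    simp only [Filter.eventually_all]
    intro i j k l
    by_cases h : (segment ℝ (p i) (p j) ∩ segment ℝ (p k) (p l)).Nonempty
    · exact Filter.Eventually.of_forall fun _ _ => h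
    · have h' : ¬ (segment ℝ (q 0 i) (q 0 j) ∩ segment ℝ (q 0 k) (q 0 l)).Nonempty := by
        simpa [q] using h
      filter_upwards [eventually_segment_disjoint (hq i) (hq j) (hq k) (hq l) h'] with t ht ht'
      exact absurd ht' ht
  obtain ⟨t, h1, h2, h3⟩ := (e1.and (e2.and e3)).exists
  refine ⟨q t, fun i j hij => ?_, h2, h3⟩
  by_contra hne
  exact h1 i j hne (sub_eq_zero.2 hij)

theorem det_eq_zero_of_mem {p q r z : Plane} (hz : z ∈ openSegment ℝ p q)
    (hz' : z ∈ segment ℝ p r) : det p q r = 0 := by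
  obtain ⟨a, b, ha, hb, hab, rfl⟩ := hz
  obtain ⟨c, d, hc, hd, hcd, h⟩ := hz'
  have e0 := congrArg (fun v : Plane => v 0) h
  have e1 := congrArg (fun v : Plane => v 1) h
  simp at e0 e1
  obtain rfl : a = 1 - b := by linarith
  obtain rfl : c = 1 - d := by linarith
  have : b * det p q r = 0 := by
    unfold det
    linear_combination -(r 1 - p 1) * e0 + (r 0 - p 0) * e1
  exact (mul_eq_zero.1 this).resolve_left hb.ne'

/-- Reconnecting two properly crossing segments makes them shorter. -/
theorem dist_exchange {p q r s z : Plane} (hdet : det p q r ≠ 0) (hz : z ∈ openSegment ℝ p q)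
    (hz' : z ∈ segment ℝ r s) :
    dist p r + dist q s < dist p q + dist r s := by
  have h1 : dist p z + dist z q = dist p q :=
    dist_add_dist_of_mem_segment (openSegment_subset_segment ℝ p q hz)
  have h2 : dist r z + dist z s = dist r s := dist_add_dist_of_mem_segment hz'
  have h3 : dist q s ≤ dist q z + dist z s := dist_triangle _ _ _
  have h4 : dist p r < dist p z + dist z r := by
    refine lt_of_le_of_ne (dist_triangle _ _ _) fun h => hdet ?_
    exact det_eq_zero_of_mem hz (mem_segment_iff_wbtw.2 (dist_add_dist_eq_iff.1 h.symm))
  rw [dist_comm z r] at h4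
  rw [dist_comm q z] at h3
  linarith

/-! ### Edges, cuts and shifts of weight -/

variable {P : Finset Plane}

/-- The edge that joins two distinct points. -/
def mkEdge (i j : P) (h : i ≠ j) : Edge P := ⟨s(i, j), by simpa using h⟩

theorem mkEdge_comm (i j : P) (h : i ≠ j) : mkEdge i j h = mkEdge j i h.symm :=
  Subtype.ext Sym2.eq_swap

theorem exists_eq_mkEdge (e : Edge P) : ∃ i j h, e = mkEdge i j h := by
  obtain ⟨e, he⟩ := e
  induction e with
  | _ i j => exact ⟨i, j, by simpa using he, rfl⟩

theorem mkEdge_mem_cut {i j : P} {h : i ≠ j} {S : Finset P} :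
    mkEdge i j h ∈ cut S ↔ (i ∈ S ∧ j ∉ S) ∨ (j ∈ S ∧ i ∉ S) := by
  simp only [cut, mkEdge, Set.mem_ofPred_eq, Sym2.eq_iff]
  constructor
  · rintro ⟨a, ha, b, hb, ⟨rfl, rfl⟩ | ⟨rfl, rfl⟩⟩
    · exact Or.inl ⟨ha, hb⟩
    · exact Or.inr ⟨ha, hb⟩
  · rintro (⟨hi, hj⟩ | ⟨hj, hi⟩)
    · exact ⟨i, hi, j, hj, Or.inl ⟨rfl, rfl⟩⟩
    · exact ⟨j, hj, i, hi, Or.inr ⟨rfl, rfl⟩⟩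

theorem mkEdge_mem_stabbed {i j : P} {h : i ≠ j} {l : AffineSubspace ℝ Plane} :
    mkEdge i j h ∈ stabbed l ↔ (segment ℝ (i : Plane) j ∩ (l : Set Plane)).Nonempty := Iff.rfl

theorem cut_compl (S : Finset P) : cut Sᶜ = cut S := by
  ext e
  obtain ⟨i, j, h, rfl⟩ := exists_eq_mkEdge e
  simp only [mkEdge_mem_cut, Finset.mem_compl, not_not]
  tauto

open Classical in
theorem weight_eq (x : Edge P → ℝ) (F : Set (Edge P)) :
    weight x F = ∑ e, if e ∈ F then x e else 0 := by
  rw [weight, Finset.sum_filter]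

theorem continuous_weight (F : Set (Edge P)) : Continuous fun x : Edge P → ℝ => weight x F := by
  unfold weight
  fun_prop

theorem weight_nonneg {x : Edge P → ℝ} (hx : ∀ e, 0 ≤ x e) (F : Set (Edge P)) :
    0 ≤ weight x F := Finset.sum_nonneg fun e _ => hx e

theorem le_weight {x : Edge P → ℝ} (hx : ∀ e, 0 ≤ x e) {F : Set (Edge P)} {e : Edge P}
    (he : e ∈ F) : x e ≤ weight x F :=
  Finset.single_le_sum (fun e _ => hx e) (by simpa using he)

theorem weight_mono {x : Edge P → ℝ} (hx : ∀ e, 0 ≤ x e) {F G : Set (Edge P)} (h : F ⊆ G) :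
    weight x F ≤ weight x G := by
  classical
  rw [weight_eq, weight_eq]
  refine Finset.sum_le_sum fun e _ => ?_
  by_cases h1 : e ∈ F
  · simp [h1, h h1]
  · simp only [h1, if_false]; split_ifs
    · exact hx e
    · exact le_rfl

open Classical in
/-- Move the weight `ε` from the edges `c` and `d` to the edges `a` and `b`. -/
noncomputable def shift (x : Edge P → ℝ) (ε : ℝ) (a b c d : Edge P) : Edge P → ℝ := fun e =>
  x e + ε * ((if e = a then 1 else 0) + (if e = b then 1 else 0) - (if e = c then 1 else 0) -
    (if e = d then 1 else 0))

theorem sum_mul_shift (w x : Edge P → ℝ) (ε : ℝ) (a b c d : Edge P) :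
    ∑ e, w e * shift x ε a b c d e = ∑ e, w e * x e + ε * (w a + w b - w c - w d) := by
  classical
  have h : ∀ a : Edge P, w a = ∑ e, w e * if e = a then (1 : ℝ) else 0 := by intro a; simp
  rw [h a, h b, h c, h d, ← Finset.sum_add_distrib, ← Finset.sum_sub_distrib,
    ← Finset.sum_sub_distrib, Finset.mul_sum, ← Finset.sum_add_distrib]
  refine Finset.sum_congr rfl fun e _ => ?_
  rw [shift]; ring

open Classical in
theorem weight_shift (x : Edge P → ℝ) (ε : ℝ) (a b c d : Edge P) (F : Set (Edge P)) :
    weight (shift x ε a b c d) F = weight x F +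
      ε * ((if a ∈ F then 1 else 0) + (if b ∈ F then 1 else 0) - (if c ∈ F then 1 else 0) -
        (if d ∈ F then 1 else 0)) := by
  have h := sum_mul_shift (fun e => if e ∈ F then 1 else 0) x ε a b c d
  simp only [ite_mul, one_mul, zero_mul] at h
  rw [weight_eq, weight_eq]
  exact h

theorem shift_nonneg {x : Edge P → ℝ} (hx : ∀ e, 0 ≤ x e) {ε : ℝ} (hε : 0 ≤ ε) {a b c d : Edge P}
    (hcd : c ≠ d) (hc : ε ≤ x c) (hd : ε ≤ x d) (e : Edge P) : 0 ≤ shift x ε a b c d e := by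
  classical
  have h := hx e
  unfold shift
  by_cases h1 : e = c
  · subst h1
    simp only [hcd, if_true, if_false]
    split_ifs <;> linarith
  · by_cases h2 : e = d
    · subst h2
      simp only [h1, if_true, if_false]
      split_ifs <;> linarith
    · simp only [h1, h2, if_false]
      split_ifs <;> linarith

/-! ### The common linear program and uncrossing -/

/-- A linear program with cut constraints for the sets in `𝒮`, stabbing constraints and equations
in `𝒜`, of which the two stabbing relaxations are special cases. -/
structure Feasible (L : Set (AffineSubspace ℝ Plane)) (𝒮 : Set (Finset P))
    (𝒜 : Set (Set (Edge P) × ℝ)) (x : Edge P → ℝ) (k : ℝ) : Prop where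
  equation : ∀ a ∈ 𝒜, weight x a.1 = a.2
  cuts : ∀ S ∈ 𝒮, 1 ≤ weight x (cut S)
  stabbing : ∀ l ∈ L, weight x (stabbed l) ≤ k
  nonneg : ∀ e, 0 ≤ x e

variable {L : Set (AffineSubspace ℝ Plane)} {𝒮 : Set (Finset P)} {𝒜 : Set (Set (Edge P) × ℝ)}

theorem isClosed_feasible :
    IsClosed {z : (Edge P → ℝ) × ℝ | Feasible L 𝒮 𝒜 z.1 z.2} := by
  have h : {z : (Edge P → ℝ) × ℝ | Feasible L 𝒮 𝒜 z.1 z.2} =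
      {z | ∀ a ∈ 𝒜, weight z.1 a.1 = a.2} ∩ {z | ∀ S ∈ 𝒮, 1 ≤ weight z.1 (cut S)} ∩
      {z | ∀ l ∈ L, weight z.1 (stabbed l) ≤ z.2} ∩ {z | ∀ e, 0 ≤ z.1 e} := by
    ext z
    exact ⟨fun h => ⟨⟨⟨h.1, h.2⟩, h.3⟩, h.4⟩, fun h => ⟨h.1.1.1, h.1.1.2, h.1.2, h.2⟩⟩
  have hw : ∀ F : Set (Edge P), Continuous fun z : (Edge P → ℝ) × ℝ => weight z.1 F :=
    fun F => (continuous_weight F).comp continuous_fst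
  rw [h]
  simp only [Set.ofPred_forall]
  refine ((IsClosed.inter ?_ ?_).inter ?_).inter ?_
  · exact isClosed_biInter fun a _ => isClosed_eq (hw _) continuous_const
  · exact isClosed_biInter fun S _ => isClosed_le continuous_const (hw _)
  · exact isClosed_biInter fun l _ => isClosed_le (hw _) continuous_snd
  · exact isClosed_iInter fun e => isClosed_le continuous_const (by fun_prop)

/-- The linear program has an optimal solution, and one of them minimizes a secondary cost. -/
theorem exists_optimal (hL : L.Nonempty) (h𝒜 : ∀ e, ∃ a ∈ 𝒜, e ∈ a.1) {x₀ : Edge P → ℝ} {k₀ : ℝ}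
    (h₀ : Feasible L 𝒮 𝒜 x₀ k₀) (c : Edge P → ℝ) :
    ∃ x k, Feasible L 𝒮 𝒜 x k ∧ (∀ x' k', Feasible L 𝒮 𝒜 x' k' → k ≤ k') ∧
      ∀ x', Feasible L 𝒮 𝒜 x' k → ∑ e, c e * x e ≤ ∑ e, c e * x' e := by
  choose a ha hea using h𝒜
  have hbox : ∀ {x k}, Feasible L 𝒮 𝒜 x k → x ∈ Set.Icc 0 (fun e => (a e).2) := by
    intro x k h
    exact ⟨h.nonneg, fun e => (le_weight h.nonneg (hea e)).trans_eq (h.equation _ (ha e))⟩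
  obtain ⟨l, hl⟩ := hL
  have hk : ∀ {x k}, Feasible L 𝒮 𝒜 x k → 0 ≤ k := fun h =>
    (weight_nonneg h.nonneg _).trans (h.stabbing l hl)
  have hcomp : ∀ k₁, IsCompact ({z : (Edge P → ℝ) × ℝ | Feasible L 𝒮 𝒜 z.1 z.2} ∩
      Set.Icc 0 (fun e => (a e).2) ×ˢ Set.Icc 0 k₁) := fun k₁ =>
    (isCompact_Icc.prod isCompact_Icc).inter_left isClosed_feasible
  -- The objective is minimized first, then the cost on the optimal face. The equations cover every
  -- edge and so bound `x`, which makes both domains compact.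
  obtain ⟨⟨x₁, k₁⟩, h₁, hmin₁⟩ := (hcomp k₀).exists_isMinOn
    ⟨(x₀, k₀), h₀, hbox h₀, hk h₀, le_rfl⟩ continuous_snd.continuousOn
  have hopt : ∀ x' k', Feasible L 𝒮 𝒜 x' k' → k₁ ≤ k' := by
    intro x' k' h'
    rcases le_total k' k₀ with h | h
    · exact hmin₁ (show (x', k') ∈ _ from ⟨h', hbox h', hk h', h⟩)
    · exact h₁.2.2.2.trans h
  have hcost : Continuous fun z : (Edge P → ℝ) × ℝ => ∑ e, c e * z.1 e := by fun_prop
  obtain ⟨⟨x₂, k₂⟩, h₂, hmin₂⟩ := (hcomp k₁).exists_isMinOn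
    ⟨(x₁, k₁), h₁.1, hbox h₁.1, hk h₁.1, le_rfl⟩ hcost.continuousOn
  obtain rfl : k₂ = k₁ := le_antisymm h₂.2.2.2 (hopt _ _ h₂.1)
  refine ⟨x₂, k₂, h₂.1, hopt, fun x' h' => ?_⟩
  exact hmin₂ (show (x', k₂) ∈ _ from ⟨h', hbox h', hk h', le_rfl⟩)

open Classical in
-- The only cuts that lose weight are those with `i`, `k` on one side and `j`, `l` on the other, and
-- these have slack by `hS`.
theorem exists_feasible_shift (hline : ∀ l ∈ L, IsLine l) (hcompl : ∀ S ∈ 𝒮, Sᶜ ∈ 𝒮)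
    {x : Edge P → ℝ} {κ : ℝ} (hx : Feasible L 𝒮 𝒜 x κ) {i j k l : P} (hij : i ≠ j) (hkl : k ≠ l)
    (hik : i ≠ k) (hjl : j ≠ l) (hil : i ≠ l)
    (h𝒜 : ∀ a ∈ 𝒜, (if mkEdge i k hik ∈ a.1 then (1 : ℝ) else 0) +
      (if mkEdge j l hjl ∈ a.1 then 1 else 0) = (if mkEdge i j hij ∈ a.1 then 1 else 0) +
      (if mkEdge k l hkl ∈ a.1 then 1 else 0))
    (pij : 0 < x (mkEdge i j hij)) (pkl : 0 < x (mkEdge k l hkl))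
    (hseg : (segment ℝ (i : Plane) j ∩ segment ℝ (k : Plane) l).Nonempty)
    (hS : ∀ S ∈ 𝒮, i ∈ S → k ∈ S → j ∉ S → l ∉ S → 1 < weight x (cut S)) :
    ∃ ε > 0, Feasible L 𝒮 𝒜
      (shift x ε (mkEdge i k hik) (mkEdge j l hjl) (mkEdge i j hij) (mkEdge k l hkl)) κ := by
  have small : ∀ r : ℝ, 0 < r → ∀ᶠ ε in nhdsWithin (0 : ℝ) (Set.Ioi 0), ε ≤ r := fun r hr =>
    (eventually_le_nhds hr).filter_mono nhdsWithin_le_nhds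
  -- Such a cut contains both old edges and neither new one, so it loses `2 * ε`; hence the half.
  have hslack : ∀ᶠ ε in nhdsWithin (0 : ℝ) (Set.Ioi 0), ∀ S : Finset P, S ∈ 𝒮 → i ∈ S → k ∈ S →
      j ∉ S → l ∉ S → ε ≤ (weight x (cut S) - 1) / 2 := by
    simp only [Filter.eventually_all]
    intro S h h1 h2 h3 h4
    exact small _ (by linarith [hS S h h1 h2 h3 h4])
  obtain ⟨ε, ⟨h1, h2, hslack⟩, hε⟩ :=
    (((small _ pij).and ((small _ pkl).and hslack)).and self_mem_nhdsWithin).exists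
  have hε : 0 < ε := hε
  refine ⟨ε, hε, fun a ha => ?_, fun S h => ?_, fun m hm => ?_, ?_⟩
  · rw [weight_shift, hx.equation a ha]
    linear_combination ε * h𝒜 a ha
  · have hw := hx.cuts S h
    have hs := hslack S h
    -- The complement defines the same cut and covers the sets that contain `j`, `l` but not `i`,
    -- `k`.
    have hs' := hslack Sᶜ (hcompl S h)
    rw [cut_compl] at hs'
    rw [weight_shift]
    simp only [mkEdge_mem_cut, Finset.mem_compl, not_not] at *
    by_cases a1 : i ∈ S <;> by_cases a2 : j ∈ S <;> by_cases a3 : k ∈ S <;> by_cases a4 : l ∈ S <;>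
      simp [a1, a2, a3, a4] at hs hs' ⊢ <;> linarith
  · refine le_trans ?_ (hx.stabbing m hm)
    rw [weight_shift]
    have := stab_exchange (hline m hm) hseg
    simp only [mkEdge_mem_stabbed]
    nlinarith
  · refine shift_nonneg hx.nonneg hε.le ?_ h1 h2
    intro h
    have h := congrArg Subtype.val h
    simp only [mkEdge, Sym2.eq_iff] at h
    tauto

/-- Two crossing cuts that are separated in opposite ways by two edges of positive weight cannot
both be tight. -/
theorem two_lt_weight_add_weight (hU : ∀ S ∈ 𝒮, ∀ T ∈ 𝒮, (S ∩ T).Nonempty → (S \ T).Nonempty →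
      (T \ S).Nonempty → S ∪ T ≠ Finset.univ →
      (S ∩ T ∈ 𝒮 ∧ S ∪ T ∈ 𝒮) ∨ (S \ T ∈ 𝒮 ∧ T \ S ∈ 𝒮))
    {x : Edge P → ℝ} (hx : ∀ e, 0 ≤ x e) (hcut : ∀ S ∈ 𝒮, 1 ≤ weight x (cut S))
    {i j k l : P} (hij : i ≠ j) (hkl : k ≠ l)
    (pij : 0 < x (mkEdge i j hij)) (pkl : 0 < x (mkEdge k l hkl)) {S T : Finset P}
    (hS : S ∈ 𝒮) (hT : T ∈ 𝒮) (iS : i ∈ S) (iT : i ∈ T) (jS : j ∉ S) (jT : j ∉ T) (kS : k ∈ S)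
    (kT : k ∉ T) (lS : l ∉ S) (lT : l ∈ T) :
    2 < weight x (cut S) + weight x (cut T) := by
  classical
  have key : ∀ A B : Finset P, (∀ e : Edge P, (if e ∈ cut A then x e else 0) +
      (if e ∈ cut B then x e else 0) ≤ (if e ∈ cut S then x e else 0) +
      (if e ∈ cut T then x e else 0)) → (∃ e : Edge P, (if e ∈ cut A then x e else 0) +
      (if e ∈ cut B then x e else 0) < (if e ∈ cut S then x e else 0) +
      (if e ∈ cut T then x e else 0)) → weight x (cut A) + weight x (cut B) <
      weight x (cut S) + weight x (cut T) := by
    rintro A B h ⟨e, he⟩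
    simp only [weight_eq, ← Finset.sum_add_distrib]
    exact Finset.sum_lt_sum (fun e _ => h e) ⟨e, Finset.mem_univ _, he⟩
  rcases hU S hS T hT ⟨i, by simp [iS, iT]⟩ ⟨k, by simp [kS, kT]⟩ ⟨l, by simp [lS, lT]⟩
    (fun h => by have := h ▸ Finset.mem_univ j; simp [jS, jT] at this) with ⟨h1, h2⟩ | ⟨h1, h2⟩
  · refine lt_of_le_of_lt (by linarith [hcut _ h1, hcut _ h2]) (key (S ∩ T) (S ∪ T) ?_ ?_)
    · intro e
      have h0 := hx e
      obtain ⟨u, v, h, rfl⟩ := exists_eq_mkEdge e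
      simp only [mkEdge_mem_cut, Finset.mem_inter, Finset.mem_union]
      by_cases a1 : u ∈ S <;> by_cases a2 : u ∈ T <;> by_cases a3 : v ∈ S <;> by_cases a4 : v ∈ T <;>
        simp [a1, a2, a3, a4] <;> linarith
    -- The edge `kl` joins `S \ T` to `T \ S`: it is in both old cuts and in neither new one.
    · refine ⟨mkEdge k l hkl, ?_⟩
      simp [mkEdge_mem_cut, kS, kT, lS, lT]
      linarith
  · refine lt_of_le_of_lt (by linarith [hcut _ h1, hcut _ h2]) (key (S \ T) (T \ S) ?_ ?_)
    · intro e
      have h0 := hx e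
      obtain ⟨u, v, h, rfl⟩ := exists_eq_mkEdge e
      simp only [mkEdge_mem_cut, Finset.mem_sdiff]
      by_cases a1 : u ∈ S <;> by_cases a2 : u ∈ T <;> by_cases a3 : v ∈ S <;> by_cases a4 : v ∈ T <;>
        simp [a1, a2, a3, a4] <;> linarith
    -- The edge `ij` joins `S ∩ T` to the outside of `S ∪ T`, so it lies in neither new cut.
    · refine ⟨mkEdge i j hij, ?_⟩
      simp [mkEdge_mem_cut, iS, iT, jS, jT]
      linarith

theorem height_mem_openSegment {ι : Type*} (q : ι → Plane) {e : ι × ι} {t : ℝ}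
    (h1 : q e.1 0 < t) (h2 : t < q e.2 0) :
    !₂[t, height (fun i => q i 0) (fun i => q i 1) e t] ∈ openSegment ℝ (q e.1) (q e.2) := by
  have h : 0 < q e.2 0 - q e.1 0 := by linarith
  refine ⟨(q e.2 0 - t) / (q e.2 0 - q e.1 0), (t - q e.1 0) / (q e.2 0 - q e.1 0),
    div_pos (by linarith) h, div_pos (by linarith) h, by field_simp; ring, ?_⟩
  ext m
  fin_cases m
  · simp; field_simp; ring
  · simp [height, slope]; field_simp; ring

/-! ### Solutions with plane support -/

/-- The length of an edge after moving the points to `q`. -/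
noncomputable def edgeLength (q : P → Plane) (e : Edge P) : ℝ :=
  Sym2.lift ⟨fun i j : P => dist (q i) (q j), fun i j => dist_comm (q i) (q j)⟩ e.1

theorem edgeLength_mkEdge (q : P → Plane) (i j : P) (h : i ≠ j) :
    edgeLength q (mkEdge i j h) = dist (q i) (q j) := rfl

open Classical in
/-- The conditions on the sets and equations of a linear program under which weight can be moved
away from one of two crossing edges. -/
structure Uncrossable (𝒮 : Set (Finset P)) (𝒜 : Set (Set (Edge P) × ℝ)) : Prop where
  compl : ∀ S ∈ 𝒮, Sᶜ ∈ 𝒮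
  uncross : ∀ S ∈ 𝒮, ∀ T ∈ 𝒮, (S ∩ T).Nonempty → (S \ T).Nonempty → (T \ S).Nonempty →
    S ∪ T ≠ Finset.univ → (S ∩ T ∈ 𝒮 ∧ S ∪ T ∈ 𝒮) ∨ (S \ T ∈ 𝒮 ∧ T \ S ∈ 𝒮)
  cover : ∀ e, ∃ a ∈ 𝒜, e ∈ a.1
  exchange : ∀ a ∈ 𝒜, ∀ i j k l : P, ∀ (hij : i ≠ j) (hkl : k ≠ l) (hik : i ≠ k) (hjl : j ≠ l),
    i ≠ l → j ≠ k → (if mkEdge i k hik ∈ a.1 then (1 : ℝ) else 0) +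
      (if mkEdge j l hjl ∈ a.1 then 1 else 0) = (if mkEdge i j hij ∈ a.1 then 1 else 0) +
      (if mkEdge k l hkl ∈ a.1 then 1 else 0)

/-- In a feasible solution of least length, edges of positive weight do not cross. -/
theorem not_crossing (hline : ∀ l ∈ L, IsLine l) (hU : Uncrossable 𝒮 𝒜) {x : Edge P → ℝ} {κ : ℝ}
    (hx : Feasible L 𝒮 𝒜 x κ) {q : P → Plane}
    (hdet : ∀ i j k, i ≠ j → i ≠ k → j ≠ k → det (q i) (q j) (q k) ≠ 0)
    (hq : ∀ i j k l, (segment ℝ (q i) (q j) ∩ segment ℝ (q k) (q l)).Nonempty →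
        (segment ℝ (i : Plane) j ∩ segment ℝ (k : Plane) l).Nonempty)
    (hmin : ∀ x', Feasible L 𝒮 𝒜 x' κ →
      ∑ e, edgeLength q e * x e ≤ ∑ e, edgeLength q e * x' e)
    {i j k l : P} (hij : i ≠ j) (hkl : k ≠ l) (hik : i ≠ k) (hjl : j ≠ l) (hil : i ≠ l)
    (hjk : j ≠ k) (pij : 0 < x (mkEdge i j hij)) (pkl : 0 < x (mkEdge k l hkl)) {z : Plane}
    (hz : z ∈ openSegment ℝ (q i) (q j)) (hz' : z ∈ openSegment ℝ (q k) (q l)) : False := by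
  have hz'' := openSegment_subset_segment ℝ _ _ hz'
  have hseg := hq i j k l ⟨z, openSegment_subset_segment ℝ _ _ hz, hz''⟩
  have hno : ∀ {ε : ℝ} {a b c d : Edge P}, 0 < ε → edgeLength q a + edgeLength q b <
      edgeLength q c + edgeLength q d → ¬ Feasible L 𝒮 𝒜 (shift x ε a b c d) κ := by
    intro ε a b c d hε hlt hf
    have h := hmin _ hf
    rw [sum_mul_shift] at h
    nlinarith
  by_cases hA : ∀ S ∈ 𝒮, i ∈ S → k ∈ S → j ∉ S → l ∉ S → 1 < weight x (cut S)
  · obtain ⟨ε, hε, hf⟩ := exists_feasible_shift hline hU.compl hx hij hkl hik hjl hil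
      (fun a ha => hU.exchange a ha i j k l hij hkl hik hjl hil hjk) pij pkl hseg hA
    refine hno hε ?_ hf
    simp only [edgeLength_mkEdge]
    exact dist_exchange (hdet i j k hij hik hjk) hz hz''
  · push Not at hA
    obtain ⟨S, hS, iS, kS, jS, lS, hw⟩ := hA
    -- The first reconnection is blocked by the tight set `S`, so any `T` relevant to the second has
    -- slack.
    obtain ⟨ε, hε, hf⟩ := exists_feasible_shift hline hU.compl hx hij hkl.symm hil hjk hik
      (fun a ha => hU.exchange a ha i j l k hij hkl.symm hil hjk hik hjl) pij
      (by rwa [mkEdge_comm]) (by rwa [segment_symm ℝ (l : Plane)])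
      (fun T hT iT lT jT kT => by
        have := two_lt_weight_add_weight hU.uncross hx.nonneg hx.cuts hij hkl pij pkl hS hT iS iT
          jS jT kS kT lS lT
        linarith)
    refine hno hε ?_ hf
    simp only [edgeLength_mkEdge]
    exact dist_exchange (hdet i j l hij hil hjl) hz (by rwa [segment_symm])

/-- The linear program has an optimal solution whose support is no larger than that of a plane
graph. -/
theorem exists_optimal_card_support (hL : L.Nonempty) (hline : ∀ l ∈ L, IsLine l)
    (hU : Uncrossable 𝒮 𝒜) (hP : 2 ≤ P.card) {x₀ : Edge P → ℝ} {k₀ : ℝ}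
    (h₀ : Feasible L 𝒮 𝒜 x₀ k₀) :
    ∃ x k, Feasible L 𝒮 𝒜 x k ∧ (∀ x' k', Feasible L 𝒮 𝒜 x' k' → k ≤ k') ∧
      (Finset.univ.filter fun e => 0 < x e).card + 5 ≤ 3 * P.card := by
  classical
  obtain ⟨q, hinj, hdet, hq⟩ := exists_general_position (fun i : P => (i : Plane))
  obtain ⟨x, κ, hx, hopt, hmin⟩ := exists_optimal hL hU.cover h₀ (edgeLength q)
  refine ⟨x, κ, hx, hopt, ?_⟩
  let E : Finset (P × P) := Finset.univ.filter fun e => q e.1 0 < q e.2 0 ∧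
    ∃ h, 0 < x (mkEdge e.1 e.2 h)
  have hE : ∀ e, e ∈ E ↔ q e.1 0 < q e.2 0 ∧ ∃ h, 0 < x (mkEdge e.1 e.2 h) := by simp [E]
  have D : PlaneDrawing (fun i => q i 0) (fun i => q i 1) E := by
    refine ⟨hinj, fun e he => ((hE e).1 he).1, ?_, ?_⟩
    · rintro ⟨i, j⟩ he ⟨k, l⟩ hf hne t h1 h2 h3 h4 heq
      obtain ⟨-, hij, pij⟩ := (hE _).1 he
      obtain ⟨-, hkl, pkl⟩ := (hE _).1 hf
      have hz := height_mem_openSegment q h1 h2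
      have hz' := height_mem_openSegment q h3 h4
      rw [← heq] at hz'
      dsimp only at *
      have hil : i ≠ l := by rintro rfl; linarith
      have hjk : j ≠ k := by rintro rfl; linarith
      -- Edges with a common endpoint cannot meet again, since three moved points are never
      -- collinear.
      by_cases hik : i = k
      · subst hik
        have hjl : j ≠ l := by rintro rfl; exact hne rfl
        exact hdet i j l hij hil hjl
          (det_eq_zero_of_mem hz (openSegment_subset_segment ℝ _ _ hz'))
      · by_cases hjl : j = l
        · subst hjl
          rw [openSegment_symm] at hz hz'
          exact hdet j i k hij.symm hjk hik
            (det_eq_zero_of_mem hz (openSegment_subset_segment ℝ _ _ hz'))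
        · exact not_crossing hline hU hx hdet hq hmin hij hkl hik hjl hil hjk pij pkl hz hz'
    · rintro ⟨i, j⟩ he w h1 h2 heq
      obtain ⟨-, hij, -⟩ := (hE _).1 he
      have hz := height_mem_openSegment q h1 h2
      rw [heq] at hz
      have hw : !₂[q w 0, q w 1] = q w := by ext m; fin_cases m <;> rfl
      rw [hw] at hz
      refine hdet i j w hij ?_ ?_ (det_eq_zero_of_mem hz (right_mem_segment ℝ _ _))
      · rintro rfl; exact lt_irrefl _ h1
      · rintro rfl; exact lt_irrefl _ h2
  have hcard := D.card_add_five_le (by simpa using hP)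
  rw [Fintype.card_coe] at hcard
  refine le_trans (Nat.add_le_add_right ?_ 5) hcard
  have hrep : ∀ e : Edge P, ∃ p : P × P, e.1 = s(p.1, p.2) ∧ (0 < x e → p ∈ E) := by
    intro e
    obtain ⟨i, j, h, rfl⟩ := exists_eq_mkEdge e
    rcases lt_or_gt_of_ne (fun h' => h (hinj h') : q i 0 ≠ q j 0) with h' | h'
    · exact ⟨(i, j), rfl, fun hpos => (hE _).2 ⟨h', h, hpos⟩⟩
    · exact ⟨(j, i), Sym2.eq_swap, fun hpos => (hE _).2 ⟨h', h.symm, by rwa [mkEdge_comm]⟩⟩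
  choose r hr hrE using hrep
  refine Finset.card_le_card_of_injOn r (fun e he => hrE e (Finset.mem_filter.1 he).2) ?_
  intro e _ f _ hef
  exact Subtype.ext (by rw [hr e, hr f, hef])

/-! ### Cut sizes and uniform feasible solutions -/

theorem weight_const (c : ℝ) (F : Set (Edge P)) : weight (fun _ => c) F = F.ncard * c := by
  classical
  rw [weight, Finset.sum_const, nsmul_eq_mul, Set.ncard_eq_toFinset_card']
  congr 3
  ext e; simp

theorem ncard_cut (S : Finset P) : (cut S).ncard = S.card * (P.card - S.card) := by
  classical
  have h : Subtype.val '' cut S =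
      (fun p : P × P => s(p.1, p.2)) '' ((S ×ˢ Sᶜ : Finset (P × P)) : Set (P × P)) := by
    ext e
    constructor
    · rintro ⟨e, ⟨i, hi, j, hj, he⟩, rfl⟩
      exact ⟨(i, j), by simp [hi, hj], he.symm⟩
    · rintro ⟨⟨i, j⟩, hp, rfl⟩
      simp only [Finset.coe_product, Finset.coe_compl, Set.mem_prod, Finset.mem_coe,
        Set.mem_compl_iff] at hp
      exact ⟨mkEdge i j (by rintro rfl; exact hp.2 hp.1), ⟨i, hp.1, j, hp.2, rfl⟩, rfl⟩
  rw [← Set.ncard_image_of_injective _ Subtype.val_injective, h, Set.InjOn.ncard_image,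
    Set.ncard_coe_finset, Finset.card_product, Finset.card_compl, Fintype.card_coe]
  rintro ⟨i, j⟩ hp ⟨k, l⟩ hp' he
  simp only [Finset.coe_product, Finset.coe_compl, Set.mem_prod, Finset.mem_coe,
    Set.mem_compl_iff, Sym2.eq_iff] at hp hp' he
  rcases he with ⟨rfl, rfl⟩ | ⟨rfl, rfl⟩
  · rfl
  · exact absurd hp.1 hp'.2

theorem weight_const_cut (c : ℝ) (S : Finset P) :
    weight (fun _ => c) (cut S) = S.card * (P.card - S.card) * c := by
  rw [weight_const, ncard_cut, Nat.cast_mul, Nat.cast_sub]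
  simpa using S.card_le_univ

theorem card_sub_one_le_mul {S : Finset P} (hS : S.Nonempty) (hS' : S ≠ Finset.univ) :
    (P.card : ℝ) - 1 ≤ S.card * (P.card - S.card) := by
  have h1 : (1 : ℝ) ≤ S.card := by exact_mod_cast hS.card_pos
  have h2 : (S.card : ℝ) + 1 ≤ P.card := by
    have := Finset.card_lt_card (Finset.ssubset_univ_iff.2 hS')
    rw [Finset.card_univ, Fintype.card_coe] at this
    exact_mod_cast this
  -- With s = |S| and n = |P|, this is (s - 1)(n - s - 1) ≥ 0.
  nlinarith [mul_nonneg (sub_nonneg.2 h1) (sub_nonneg.2 h2)]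

theorem ne_univ_of_notMem {S : Finset P} {i : P} (h : i ∉ S) : S ≠ Finset.univ := by
  rintro rfl; exact h (Finset.mem_univ i)

theorem ssubset_sets_of_crossing {S T : Finset P} (h1 : (S ∩ T).Nonempty) (h2 : (S \ T).Nonempty) :
    (S ∪ T).Nonempty ∧ S ∩ T ≠ Finset.univ ∧ S \ T ≠ Finset.univ ∧
      T \ S ≠ Finset.univ := by
  obtain ⟨i, hi⟩ := h1
  obtain ⟨k, hk⟩ := h2
  have hi := Finset.mem_inter.1 hi
  have hk := Finset.mem_sdiff.1 hk
  refine ⟨⟨i, by simp [hi]⟩, ne_univ_of_notMem (i := k) (by simp [hk]),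
    ne_univ_of_notMem (i := i) (by simp [hi]), ne_univ_of_notMem (i := i) (by simp [hi])⟩

theorem compl_nonempty_ne_univ {S : Finset P} (h : S.Nonempty) (h' : S ≠ Finset.univ) :
    Sᶜ.Nonempty ∧ Sᶜ ≠ Finset.univ := by
  obtain ⟨i, hi⟩ := h
  exact ⟨by rwa [← Finset.compl_ne_univ_iff_nonempty, compl_compl],
    ne_univ_of_notMem (i := i) (by simpa)⟩

theorem weight_stabbed_le {x : Edge P → ℝ} (hx : ∀ e, 0 ≤ x e)
    (l : AffineSubspace ℝ Plane) : weight x (stabbed l) ≤ weight x Set.univ :=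
  weight_mono hx (Set.subset_univ _)

/-! ### Matchings -/

/-- The vertex sets of the blossom inequalities. -/
def blossomSets (P : Finset Plane) : Set (Finset P) :=
  {S | S.Nonempty ∧ S ≠ Finset.univ ∧ Odd S.card}

/-- The degree equations of a matching. -/
def degreeEquations (P : Finset Plane) : Set (Set (Edge P) × ℝ) :=
  Set.range fun i : P => (cut {i}, 1)

theorem matchingFeasible_iff {L : Set (AffineSubspace ℝ Plane)} {x : Edge P → ℝ} {k : ℝ} :
    MatchingFeasible P L x k ↔ Feasible L (blossomSets P) (degreeEquations P) x k := by
  constructor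
  · intro h
    exact ⟨by rintro _ ⟨i, rfl⟩; exact h.degree i, fun S hS => h.blossom S hS.1 hS.2.1 hS.2.2,
      h.stabbing, h.nonneg⟩
  · intro h
    exact ⟨fun i => h.equation _ ⟨i, rfl⟩, fun S h1 h2 h3 => h.cuts S ⟨h1, h2, h3⟩,
      h.stabbing, h.nonneg⟩

/-- For odd `S` and `T`, either the intersection and the union are both odd, or both differences
are. Evenness of `P` keeps complements odd. -/
theorem uncrossable_matching (hP : Even P.card) :
    Uncrossable (blossomSets P) (degreeEquations P) := by
  classical
  refine ⟨?_, ?_, ?_, ?_⟩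
  · rintro S ⟨h1, h2, h3⟩
    obtain ⟨h4, h5⟩ := compl_nonempty_ne_univ h1 h2
    refine ⟨h4, h5, ?_⟩
    rw [Finset.card_compl, Fintype.card_coe]
    refine Nat.Even.sub_odd ?_ hP h3
    simpa using S.card_le_univ
  · rintro S ⟨-, -, hS⟩ T ⟨-, -, hT⟩ h1 h2 h3 h4
    obtain ⟨h5, h6, h7, h8⟩ := ssubset_sets_of_crossing h1 h2
    have e1 := Finset.card_inter_add_card_sdiff S T
    have e2 := Finset.card_inter_add_card_sdiff T S
    have e3 := Finset.card_union_add_card_inter S T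
    rw [Finset.inter_comm] at e2
    have parity : ∀ {a b c d s t : ℕ}, Odd s → Odd t → a + b = s → a + c = t → d + a = s + t →
        (Even a → Odd b ∧ Odd c) ∧ (Odd a → Odd d) := by
      intro a b c d s t h1 h2 h3 h4 h5
      simp only [Nat.odd_iff, Nat.even_iff] at *
      omega
    obtain ⟨p1, p2⟩ := parity hS hT e1 e2 e3
    rcases Nat.even_or_odd (S ∩ T).card with h | h
    · exact Or.inr ⟨⟨h2, h7, (p1 h).1⟩, ⟨h3, h8, (p1 h).2⟩⟩
    · exact Or.inl ⟨⟨h1, h6, h⟩, ⟨h5, h4, p2 h⟩⟩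
  · intro e
    obtain ⟨i, j, h, rfl⟩ := exists_eq_mkEdge e
    exact ⟨_, ⟨i, rfl⟩, by simp [mkEdge_mem_cut, h.symm]⟩
  · rintro _ ⟨v, rfl⟩ i j k l hij hkl hik hjl hil hjk
    simp only [mkEdge_mem_cut, Finset.mem_singleton]
    by_cases a1 : i = v
    · subst a1; simp [hij.symm, hik.symm, hil.symm]
    · by_cases a2 : j = v
      · subst a2; simp [a1, hjk.symm, hjl.symm]
      · by_cases a3 : k = v
        · subst a3; simp [a1, a2, hkl.symm]
        · simp [a1, a2, a3]

theorem matchingFeasible_uniform (hP : P.Nonempty) (hP' : Even P.card)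
    (L : Set (AffineSubspace ℝ Plane)) : ∃ x k, MatchingFeasible P L x k := by
  have h2 : (2 : ℝ) ≤ P.card := by
    have := hP.card_pos
    have : 2 ≤ P.card := by grind
    exact_mod_cast this
  have h1 : (0 : ℝ) < P.card - 1 := by linarith
  have h0 : ∀ e : Edge P, (0 : ℝ) ≤ (fun _ => 1 / ((P.card : ℝ) - 1)) e := fun _ => by positivity
  refine ⟨fun _ => 1 / ((P.card : ℝ) - 1), _, fun i => ?_, fun S hS hS' _ => ?_,
    fun l _ => weight_stabbed_le h0 l, h0⟩
  · rw [weight_const_cut]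
    simp [h1.ne']
  · rw [weight_const_cut, mul_one_div, one_le_div h1]
    exact card_sub_one_le_mul hS hS'

open Classical in
theorem sum_card_filter_mem_cut (T : Finset (Edge P)) :
    ∑ i : P, (T.filter fun e => e ∈ cut {i}).card = 2 * T.card := by
  have h := Finset.sum_card_bipartiteAbove_eq_sum_card_bipartiteBelow
    (s := (Finset.univ : Finset P)) (t := T) (fun i e => e ∈ cut {i})
  simp only [Finset.bipartiteAbove, Finset.bipartiteBelow] at h
  rw [h, Finset.sum_const_nat (m := 2), mul_comm]
  intro e _
  obtain ⟨i, j, hij, rfl⟩ := exists_eq_mkEdge e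
  rw [← Finset.card_pair hij]
  congr 1
  ext v
  simp only [mkEdge_mem_cut, Finset.mem_filter, Finset.mem_univ, true_and, Finset.mem_singleton,
    Finset.mem_insert]
  grind

theorem weight_eq_sum_support {x : Edge P → ℝ} (hx : ∀ e, 0 ≤ x e) (F : Set (Edge P))
    [DecidablePred (· ∈ F)] :
    weight x F = ∑ e ∈ (Finset.univ.filter fun e => 0 < x e).filter (· ∈ F), x e := by
  classical
  rw [weight, Finset.filter_comm, Finset.sum_filter_of_ne (p := fun e => 0 < x e)]
  · exact Finset.sum_congr (by ext; simp) fun _ _ => rfl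
  · intro e _ h
    exact lt_of_le_of_ne (hx e) h.symm

/-- Fewer than six support edges at a point, each lighter than 1/5, cannot add up to 1; but a
support of at most 3n - 5 edges has average degree below 6. -/
theorem exists_fifth_le {x : Edge P → ℝ} (hx : ∀ e, 0 ≤ x e) (hdeg : ∀ i, weight x (cut {i}) = 1)
    (hcard : (Finset.univ.filter fun e => 0 < x e).card + 5 ≤ 3 * P.card) : ∃ e, 1 / 5 ≤ x e := by
  classical
  by_contra! hlt
  set T := Finset.univ.filter fun e => 0 < x e
  have h6 : ∀ i : P, 6 ≤ (T.filter fun e => e ∈ cut {i}).card := by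
    intro i
    have h1 := hdeg i
    rw [weight_eq_sum_support hx] at h1
    have hne : (T.filter fun e => e ∈ cut {i}).Nonempty := by
      by_contra h
      rw [Finset.not_nonempty_iff_eq_empty] at h
      rw [h] at h1
      simp at h1
    have h2 := Finset.sum_lt_sum_of_nonempty hne fun e _ => hlt e
    rw [h1, Finset.sum_const, nsmul_eq_mul] at h2
    have h3 : ((5 : ℕ) : ℝ) < (T.filter fun e => e ∈ cut {i}).card := by push_cast; linarith
    exact_mod_cast h3
  have h := Finset.sum_le_sum fun i (_ : i ∈ (Finset.univ : Finset P)) => h6 i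
  rw [sum_card_filter_mem_cut] at h
  simp at h
  omega

/-! ### Trees -/

/-- The vertex sets of the cut inequalities of a spanning tree. -/
def properSets (P : Finset Plane) : Set (Finset P) := {S | S.Nonempty ∧ S ≠ Finset.univ}

/-- The equation that fixes the total weight of a spanning tree. -/
def totalEquation (P : Finset Plane) : Set (Set (Edge P) × ℝ) := {(Set.univ, (P.card : ℝ) - 1)}

theorem treeFeasible_iff {L : Set (AffineSubspace ℝ Plane)} {x : Edge P → ℝ} {k : ℝ} :
    TreeFeasible P L x k ↔ Feasible L (properSets P) (totalEquation P) x k := by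
  constructor
  · intro h
    exact ⟨by rintro _ rfl; exact h.total, fun S hS => h.connected S hS.1 hS.2,
      h.stabbing, h.nonneg⟩
  · intro h
    exact ⟨h.equation _ rfl, fun S h1 h2 => h.cuts S ⟨h1, h2⟩, h.stabbing, h.nonneg⟩

theorem uncrossable_tree : Uncrossable (properSets P) (totalEquation P) := by
  classical
  refine ⟨fun S h => compl_nonempty_ne_univ h.1 h.2, ?_, fun e => ⟨_, rfl, trivial⟩, ?_⟩
  · rintro S - T - h1 h2 h3 h4
    obtain ⟨h5, h6, -, -⟩ := ssubset_sets_of_crossing h1 h2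
    exact Or.inl ⟨⟨h1, h6⟩, ⟨h5, h4⟩⟩
  · rintro _ rfl i j k l hij hkl hik hjl - -
    simp

theorem treeFeasible_uniform (hP : 2 ≤ P.card) (L : Set (AffineSubspace ℝ Plane)) :
    ∃ x k, TreeFeasible P L x k := by
  have h2 : (2 : ℝ) ≤ P.card := by exact_mod_cast hP
  have h1 : (0 : ℝ) < P.card := by linarith
  have h0 : ∀ e : Edge P, (0 : ℝ) ≤ (fun _ => 2 / (P.card : ℝ)) e := fun _ => by positivity
  refine ⟨fun _ => 2 / (P.card : ℝ), _, ?_, fun S hS hS' => ?_,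
    fun l _ => weight_stabbed_le h0 l, h0⟩
  · have hc : (Set.univ : Set (Edge P)).ncard = P.card.choose 2 := by
      classical
      rw [Set.ncard_univ, Nat.card_eq_fintype_card, ← SimpleGraph.edgeFinset_card,
        SimpleGraph.card_edgeFinset_top_eq_card_choose_two, Fintype.card_coe]
    rw [weight_const, hc, Nat.cast_choose_two]
    field_simp
  · rw [weight_const_cut, mul_div_assoc', le_div_iff₀ h1]
    have := card_sub_one_le_mul hS hS'
    linarith

/-- The average weight on the support is at least (n - 1)/(3n - 5), which exceeds 1/3. -/
theorem exists_third_lt {x : Edge P → ℝ} (hx : ∀ e, 0 ≤ x e)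
    (htotal : weight x Set.univ = (P.card : ℝ) - 1)
    (hcard : (Finset.univ.filter fun e => 0 < x e).card + 5 ≤ 3 * P.card) : ∃ e, 1 / 3 < x e := by
  classical
  by_contra! hle
  rw [weight_eq_sum_support hx] at htotal
  simp only [Set.mem_univ, Finset.filter_true] at htotal
  have h := Finset.sum_le_sum fun e (_ : e ∈ Finset.univ.filter fun e => 0 < x e) => hle e
  rw [htotal, Finset.sum_const, nsmul_eq_mul] at h
  have hcard : ((Finset.univ.filter fun e => 0 < x e).card : ℝ) + 5 ≤ 3 * P.card := by
    exact_mod_cast hcard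
  linarith

end StabbingLP

theorem mainTheorem2 (L : Set (AffineSubspace ℝ StabbingLP.Plane))
    (hL : L.Nonempty) (hline : ∀ l ∈ L, StabbingLP.IsLine l) :
    (∀ P : Finset StabbingLP.Plane, P.Nonempty → Even P.card →
      ∃ x : StabbingLP.Edge P → ℝ, StabbingLP.IsOptimalMatching P L x ∧ ∃ e, 1 / 5 ≤ x e) ∧
    (∀ P : Finset StabbingLP.Plane, 2 ≤ P.card →
      ∃ x : StabbingLP.Edge P → ℝ, StabbingLP.IsOptimalTree P L x ∧ ∃ e, 1 / 3 < x e) := by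
  refine ⟨fun P hP hP' => ?_, fun P hP => ?_⟩
  · have h2 : 2 ≤ P.card := by
      have := hP.card_pos
      grind
    obtain ⟨x₀, k₀, h₀⟩ := StabbingLP.matchingFeasible_uniform hP hP' L
    obtain ⟨x, k, hx, hopt, hcard⟩ := StabbingLP.exists_optimal_card_support hL hline
      (StabbingLP.uncrossable_matching hP') h2 (StabbingLP.matchingFeasible_iff.1 h₀)
    have hx' := StabbingLP.matchingFeasible_iff.2 hx
    exact ⟨x, ⟨k, hx', fun x' k' h => hopt x' k' (StabbingLP.matchingFeasible_iff.1 h)⟩,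
      StabbingLP.exists_fifth_le hx'.nonneg hx'.degree hcard⟩
  · obtain ⟨x₀, k₀, h₀⟩ := StabbingLP.treeFeasible_uniform hP L
    obtain ⟨x, k, hx, hopt, hcard⟩ := StabbingLP.exists_optimal_card_support hL hline
      StabbingLP.uncrossable_tree hP (StabbingLP.treeFeasible_iff.1 h₀)
    have hx' := StabbingLP.treeFeasible_iff.2 hx
    exact ⟨x, ⟨k, hx', fun x' k' h => hopt x' k' (StabbingLP.treeFeasible_iff.1 h)⟩,
      StabbingLP.exists_third_lt hx'.nonneg hx'.total hcard⟩
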